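/- Let $t_1,t_2,\dots$ be indeterminates and define polynomials $h_k\in\mathbb{C}[t_1,t_2,\dots]$ by $$\sum_{k\ge 0}h_k(t_1,t_2,\dots)\,z^k=\exp\Big(\sum_{j\ge 1}t_jz^j\Big),\qquad h_k=0\ \text{ for } k<0 .$$ For a partition $\lambda=(\lambda_1\ge\dots\ge\lambda_{\ell(\lambda)}>0)$ let $$s_\lambda(t_1,t_2,\dots)=\det_{1\le i,j\le \ell(\lambda)}\big(h_{\lambda_i-i+j}(t_1,t_2,\dots)\big)$$ be the Schur polynomial of $\lambda$ written in the normalized power sum variables $t_j=p_j/j$ (with $s_\emptyset=1$). Let $r\ge 1$ and $n\ge 0$ be integers and let $\lambda$ be a partition of $|\lambda|=rn$. Let $g_\lambda^{(r)}$ be the Kostka number $K_{\lambda,(r^n)}$, that is, the number of semistandard Young tableaux of shape $\lambda$ and content $1^r2^r\cdots n^r$ (each of $1,\dots,n$ occurs exactly $r$ times, and no other entry occurs). Then $$g_\lambda^{(r)}=\frac{1}{\pi^r}\int_{\mathbb{C}}\cdots\int_{\mathbb{C}} s_\lambda(t_1,\dots,t_r,0,0,\dots)\;\overline{\Big(h_r\big(t_1,\tfrac{t_2}{2},\dots,\tfrac{t_r}{r},0,0,\dots\big)\Big)^{n}}\;\prod_{j=1}^{r}e^{-|t_j|^2}\,dA(t_j),$$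 where $dA$ is the area measure on $\mathbb{C}$ and the integral converges absolutely. -/

import Mathlib

open MeasureTheory
open scoped ComplexConjugate

noncomputable section

namespace KostkaIntegral

/-- The formal power series `t₁ z + t₂ z² + t₃ z³ + ⋯` in `z`, with coefficients in the
polynomial ring `ℂ[t₁, t₂, …]` (the variable `t_j` is `MvPolynomial.X j`, `j : ℕ+`). -/
def timeSeries : PowerSeries (MvPolynomial ℕ+ ℂ) :=
  PowerSeries.mk fun j => if h : 0 < j then MvPolynomial.X ⟨j, h⟩ else 0

/-- The series has no constant term, so it may be substituted into the exponential series. -/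
theorem hasSubst_timeSeries : PowerSeries.HasSubst timeSeries :=
  PowerSeries.HasSubst.of_constantCoeff_zero' (by
    rw [← PowerSeries.coeff_zero_eq_constantCoeff_apply]
    simp [timeSeries])

/-- The complete symmetric polynomial `h_k(t)` in the normalized power sum variables:
`∑ₖ h_k(t) z^k = exp (∑_{j ≥ 1} t_j z^j)`. -/
def completeSym (k : ℕ) : MvPolynomial ℕ+ ℂ :=
  PowerSeries.coeff k ((PowerSeries.exp (MvPolynomial ℕ+ ℂ)).subst timeSeries)

/-- `h_k(t)` for an integer index, with `h_k = 0` for `k < 0`. -/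
def completeSymInt (k : ℤ) : MvPolynomial ℕ+ ℂ :=
  if 0 ≤ k then completeSym k.toNat else 0

/-- The Schur polynomial `s_μ(t)` in the normalized power sum variables, by the Jacobi-Trudi
formula. The partition is given by its Young diagram: `μ.rowLen i` is its part number `i + 1`,
and `μ.colLen 0` is its number of parts. -/
def schurPoly (μ : YoungDiagram) : MvPolynomial ℕ+ ℂ :=
  Matrix.det (Matrix.of fun i j : Fin (μ.colLen 0) =>
    completeSymInt ((μ.rowLen i : ℤ) - (i : ℤ) + (j : ℤ)))

/-- The number of cells of `μ` in which the tableau `T` has the entry `k`. -/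
def entryCount {μ : YoungDiagram} (T : SemistandardYoungTableau μ) (k : ℕ) : ℕ :=
  (μ.cells.filter fun c => T c.1 c.2 = k).card

/-- The number of semistandard Young tableaux of shape `μ` with content `1^r 2^r ⋯ n^r`:
each of `1, …, n` occurs exactly `r` times, and no other entry occurs. -/
def rectKostka (μ : YoungDiagram) (r n : ℕ) : ℕ :=
  Nat.card {T : SemistandardYoungTableau μ //
    ∀ k : ℕ, entryCount T k = if k ∈ Finset.Icc 1 n then r else 0}

/-- The point `(u₁, …, u_r, 0, 0, …)`; the coordinate `u_j` is `u ⟨j - 1, _⟩`. -/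
def zeroPad {r : ℕ} (u : Fin r → ℂ) (j : ℕ+) : ℂ :=
  if h : (j : ℕ) - 1 < r then u ⟨(j : ℕ) - 1, h⟩ else 0

/-- The integrand
`s_μ(t₁, …, t_r, 0, …) · conj (h_r(t₁, t₂/2, …, t_r/r, 0, …)ⁿ) · ∏ⱼ exp (-|t_j|²)`. -/
def integrand (μ : YoungDiagram) (r n : ℕ) (t : Fin r → ℂ) : ℂ :=
  MvPolynomial.eval (zeroPad t) (schurPoly μ)
    * conj ((MvPolynomial.eval (zeroPad fun j => t j / ((j : ℂ) + 1)) (completeSym r)) ^ n)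
    * ∏ j : Fin r, (Real.exp (-‖t j‖ ^ 2) : ℂ)

end KostkaIntegral

end

open KostkaIntegral

/-!
In the variables `t_j = p_j / j` the Hall inner product of symmetric functions becomes
`⟨t^a, t^b⟩ = δ_{ab} ∏ a_j! / j^{a_j}`. The Gaussian moments
`π^{-r} ∫ t^a conj (t^b) exp (-|t|²) = δ_{ab} ∏ a_j!` therefore realize it as soon as the variables
`t_j` of the second argument are rescaled to `t_j / j`, so that the integral is `⟨s_μ, h_r ^ n⟩`.
The restriction to `t₁, …, t_r` is harmless, because `h_r` involves no further variables.

Adjointness is proved without expanding `h_r` in monomials. For the Gaussian pairing,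
multiplication by `t_j` is adjoint to `∂ / ∂t_j` (`gaussianPairing_mul_X`). Newton's recurrence
for `h_k` and the recurrence `mul_skew`, which is differentiation in `z`, then show by induction
that multiplication by `h_k(t₁, t₂ / 2, …)` is adjoint to `skew k`, the extraction of the
coefficient of `z ^ k` in `f(t₁ + z, t₂ + z² / 2, …)`
(`gaussianPairing_mul_scaledCompleteSym`).

The substitution `t_j ↦ t_j + z ^ j / j` sends `h_k` to `∑ h_{k-p} z ^ p`. Row operations and
multilinearity turn the Jacobi-Trudi determinant of `μ` into the sum of the Jacobi-Trudi
determinants of the shapes `κ` interlacing with `μ`, with weight `z ^ (|μ| - |κ|)`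
(`adjoinLetter_jacobiTrudi`). Hence each of the `n` factors `h_r` removes a horizontal strip of
size `r` in all possible ways, and the integral is `π ^ r` times the number of chains of such
removals that end in the empty shape (`gaussianPairing_jacobiTrudi`). Such chains are
semistandard tableaux of content `1^r ⋯ n^r`, the strips being the sets of cells with equal entry
(`exists_finset_isRectTableau`).
-/

namespace KostkaIntegral

open Polynomial (C X)

/-! ### Complete symmetric polynomials and Newton's recurrence -/

theorem completeSymInt_of_neg {k : ℤ} (hk : k < 0) : completeSymInt k = 0 := by
  simp [completeSymInt, not_le.mpr hk]

theorem completeSymInt_natCast (k : ℕ) : completeSymInt k = completeSym k := by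
  simp [completeSymInt]

theorem coeff_succ_timeSeries (j : ℕ) :
    PowerSeries.coeff (j + 1) timeSeries = MvPolynomial.X j.succPNat := by
  rw [timeSeries, PowerSeries.coeff_mk, dif_pos j.succ_pos]
  rfl

theorem completeSym_zero : completeSym 0 = 1 := by
  have hT : PowerSeries.constantCoeff timeSeries = 0 := by
    rw [← PowerSeries.coeff_zero_eq_constantCoeff_apply]
    simp [timeSeries]
  rw [completeSym, PowerSeries.coeff_subst' hasSubst_timeSeries, finsum_eq_single _ 0]
  · simp
  · intro d hd
    simp [hT, hd]

/-- Newton's recurrence, which is the differential equation `H' = T' H` satisfied by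
`H = exp T`. -/
theorem succ_mul_completeSym (k : ℕ) :
    ((k : MvPolynomial ℕ+ ℂ) + 1) * completeSym (k + 1) =
      ∑ j ∈ Finset.range (k + 1),
        ((j : MvPolynomial ℕ+ ℂ) + 1) * MvPolynomial.X j.succPNat * completeSym (k - j) := by
  have h := congrArg (PowerSeries.coeff k)
    (PowerSeries.derivative_subst (f := PowerSeries.exp (MvPolynomial ℕ+ ℂ)) hasSubst_timeSeries)
  rw [PowerSeries.derivative_exp, PowerSeries.coeff_derivative, mul_comm (PowerSeries.subst _ _),
    PowerSeries.coeff_mul, Finset.Nat.sum_antidiagonal_eq_sum_range_succ_mk] at h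
  rw [mul_comm, completeSym, h]
  refine Finset.sum_congr rfl fun j _ => ?_
  rw [PowerSeries.coeff_derivative, coeff_succ_timeSeries, completeSym,
    mul_comm (MvPolynomial.X _)]

/-- Newton's recurrence for integer indices; the range of summation may be any that covers all
nonzero terms. -/
theorem mul_completeSymInt {k : ℤ} {N : ℕ} (hN : k ≤ N) :
    (k : MvPolynomial ℕ+ ℂ) * completeSymInt k =
      ∑ j ∈ Finset.range N,
        ((j : MvPolynomial ℕ+ ℂ) + 1) * MvPolynomial.X j.succPNat *
          completeSymInt (k - (j + 1)) := by
  rcases le_or_gt k 0 with hk | hk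
  · rw [Finset.sum_eq_zero]
    · rcases hk.eq_or_lt with rfl | hk
      · simp
      · simp [completeSymInt_of_neg hk]
    · intro j _
      rw [completeSymInt_of_neg (by omega), mul_zero]
  · obtain ⟨m, rfl⟩ : ∃ m : ℕ, k = (m + 1 : ℕ) := ⟨(k - 1).toNat, by omega⟩
    rw [← Finset.sum_subset (Finset.range_subset_range.mpr (Nat.cast_le.mp hN))]
    · rw [completeSymInt_natCast]
      push_cast
      rw [succ_mul_completeSym]
      refine Finset.sum_congr rfl fun j hj => ?_
      rw [← completeSymInt_natCast, Nat.cast_sub (by simpa [Nat.lt_succ_iff] using hj)]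
      congr 2
      ring
    · intro j _ hj
      rw [Finset.mem_range] at hj
      rw [completeSymInt_of_neg (by push_cast; omega), mul_zero]

/-- The identity `∂h_k / ∂t_j = h_{k-j}`, with the variable `t_{j+1}` indexed by `j.succPNat`. It is
obtained by differentiating Newton's recurrence, as `k = (k - j) + j`. -/
theorem pderiv_completeSymInt (j : ℕ) (k : ℤ) :
    MvPolynomial.pderiv j.succPNat (completeSymInt k) = completeSymInt (k - (j + 1)) := by
  suffices ∀ N : ℕ, ∀ k : ℤ, k < N →
      MvPolynomial.pderiv j.succPNat (completeSymInt k) = completeSymInt (k - (j + 1)) from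
    this (k.toNat + 1) k (by omega)
  intro N
  induction N with
  | zero =>
    intro k hk
    rw [completeSymInt_of_neg (by simpa using hk), completeSymInt_of_neg (by push_cast at hk; omega),
      map_zero]
  | succ N ih =>
    intro k hk
    rcases lt_trichotomy k 0 with h0 | rfl | h0
    · rw [completeSymInt_of_neg h0, completeSymInt_of_neg (by omega), map_zero]
    · rw [completeSymInt_of_neg (k := 0 - _) (by omega)]
      have : completeSymInt 0 = 1 := by
        simpa [completeSym_zero] using completeSymInt_natCast 0
      simp [this]
    · have hk0 : (k : MvPolynomial ℕ+ ℂ) ≠ 0 := by exact_mod_cast h0.ne'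
      refine mul_left_cancel₀ hk0 ?_
      have h1 := congrArg (MvPolynomial.pderiv j.succPNat)
        (mul_completeSymInt (k := k) (N := k.toNat + j + 1) (by push_cast; omega))
      have h2 := mul_completeSymInt (k := k - (j + 1)) (N := k.toNat + j + 1) (by push_cast; omega)
      have hc : MvPolynomial.pderiv j.succPNat (k : MvPolynomial ℕ+ ℂ) = 0 := by
        simp
      rw [Derivation.leibniz, hc, smul_zero, add_zero, smul_eq_mul, map_sum] at h1
      rw [h1]
      have h3 : ∀ i ∈ Finset.range (k.toNat + j + 1), MvPolynomial.pderiv j.succPNat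
          (((i : MvPolynomial ℕ+ ℂ) + 1) * MvPolynomial.X i.succPNat *
            completeSymInt (k - (i + 1))) =
          ((i : MvPolynomial ℕ+ ℂ) + 1) * MvPolynomial.X i.succPNat *
            completeSymInt (k - (j + 1) - (i + 1)) +
          (if i = j then ((j : MvPolynomial ℕ+ ℂ) + 1) * completeSymInt (k - (j + 1)) else 0) := by
        intro i _
        have hi : MvPolynomial.pderiv j.succPNat ((i : MvPolynomial ℕ+ ℂ) + 1) = 0 := by
          simp
        rw [Derivation.leibniz, Derivation.leibniz, hi, ih _ (by push_cast at hk; omega),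
          MvPolynomial.pderiv_X]
        have e : k - ((i : ℤ) + 1) - (j + 1) = k - (j + 1) - (i + 1) := by ring
        rw [e]
        by_cases hij : i = j
        · subst hij
          simp
          ring
        · have : j.succPNat ≠ i.succPNat := fun h => hij (Nat.succPNat_injective h).symm
          simp [hij, this.symm]
      rw [Finset.sum_congr rfl h3, Finset.sum_add_distrib, ← h2,
        Finset.sum_ite_eq' _ _ fun _ => _, if_pos (by simp)]
      push_cast
      ring

/-! ### Adjoining a letter to the alphabet -/

/-- The substitution `t_j ↦ t_j + z ^ j / j`, as a homomorphism to polynomials in `z`: it adjoins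
one letter `z` to the alphabet whose power sums are `j t_j`. -/
noncomputable def adjoinLetter : MvPolynomial ℕ+ ℂ →ₐ[ℂ] Polynomial (MvPolynomial ℕ+ ℂ) :=
  MvPolynomial.aeval fun j : ℕ+ =>
    C (MvPolynomial.X j) + C (MvPolynomial.C (j : ℂ)⁻¹) * X ^ (j : ℕ)

/-- The coefficient of `z ^ k` in `f(t₁ + z, t₂ + z² / 2, …)`; for the Hall inner product this
is the adjoint of multiplication by `h_k`. -/
noncomputable def skew (k : ℕ) (f : MvPolynomial ℕ+ ℂ) : MvPolynomial ℕ+ ℂ :=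
  (adjoinLetter f).coeff k

theorem skew_zero (f : MvPolynomial ℕ+ ℂ) : skew 0 f = f := by
  have : ((Polynomial.aeval (0 : MvPolynomial ℕ+ ℂ)).restrictScalars ℂ).comp adjoinLetter =
      AlgHom.id ℂ (MvPolynomial ℕ+ ℂ) := by
    ext j
    simp [adjoinLetter]
  have h := DFunLike.congr_fun this f
  simpa [skew, Polynomial.coeff_zero_eq_aeval_zero] using h

theorem skew_add (k : ℕ) (f g : MvPolynomial ℕ+ ℂ) : skew k (f + g) = skew k f + skew k g := by
  simp [skew]

theorem skew_mul_X (k : ℕ) (f : MvPolynomial ℕ+ ℂ) (j : ℕ+) :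
    skew k (f * MvPolynomial.X j) = skew k f * MvPolynomial.X j +
      if (j : ℕ) ≤ k then skew (k - j) f * MvPolynomial.C (j : ℂ)⁻¹ else 0 := by
  have : adjoinLetter (MvPolynomial.X j) =
      C (MvPolynomial.X j) + C (MvPolynomial.C (j : ℂ)⁻¹) * X ^ (j : ℕ) := by
    simp [adjoinLetter]
  rw [skew, map_mul, this, mul_add, Polynomial.coeff_add, Polynomial.coeff_mul_C, ← mul_assoc,
    Polynomial.coeff_mul_X_pow']
  simp only [Polynomial.coeff_mul_C, skew]

/-- Differentiation of `f(t₁ + z, t₂ + z² / 2, …)` with respect to `z`. -/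
theorem mul_skew (k : ℕ) (f : MvPolynomial ℕ+ ℂ) :
    (k : MvPolynomial ℕ+ ℂ) * skew k f =
      ∑ j ∈ Finset.range k, skew (k - (j + 1)) (MvPolynomial.pderiv j.succPNat f) := by
  induction f using MvPolynomial.induction_on generalizing k with
  | C a =>
    have : adjoinLetter (MvPolynomial.C a) = C (MvPolynomial.C a) := by
      rw [← MvPolynomial.algebraMap_eq, AlgHom.commutes]
      rfl
    rcases k with _ | k <;> simp [skew, this, Polynomial.coeff_C]
  | add f g hf hg =>
    simp only [skew_add, map_add, Finset.sum_add_distrib, mul_add, hf, hg]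
  | mul_X f n ih =>
    have h1 : ∀ j ∈ Finset.range k,
        skew (k - (j + 1)) (MvPolynomial.pderiv j.succPNat (f * MvPolynomial.X n)) =
        skew (k - (j + 1)) (MvPolynomial.pderiv j.succPNat f) * MvPolynomial.X n +
        (if (n : ℕ) ≤ k - (j + 1) then
          skew (k - (j + 1) - n) (MvPolynomial.pderiv j.succPNat f) * MvPolynomial.C (n : ℂ)⁻¹
          else 0) +
        (if j = n.natPred then skew (k - n) f else 0) := by
      intro j _
      rw [Derivation.leibniz, skew_add, smul_eq_mul, smul_eq_mul, mul_comm (MvPolynomial.X n),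
        skew_mul_X, MvPolynomial.pderiv_X]
      by_cases hj : j = n.natPred
      · subst hj
        have : n.natPred + 1 = n := PNat.natPred_add_one n
        simp [this]
        ring
      · have : n ≠ j.succPNat := by
          rintro rfl
          simp at hj
        simp [hj, this, skew]
    rw [Finset.sum_congr rfl h1, Finset.sum_add_distrib, Finset.sum_add_distrib, ← Finset.sum_mul,
      ← ih k, Finset.sum_ite_eq' _ _ fun _ => _, skew_mul_X]
    have hn := PNat.natPred_add_one n
    by_cases hnk : (n : ℕ) ≤ k
    · rw [if_pos hnk, if_pos (by simp; omega)]
      obtain ⟨m, rfl⟩ := Nat.exists_eq_add_of_le' hnk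
      have h2 : ∑ j ∈ Finset.range (m + n), (if (n : ℕ) ≤ m + n - (j + 1) then
          skew (m + n - (j + 1) - n) (MvPolynomial.pderiv j.succPNat f) * MvPolynomial.C (n : ℂ)⁻¹
          else 0) = (m : MvPolynomial ℕ+ ℂ) * skew m f * MvPolynomial.C (n : ℂ)⁻¹ := by
        rw [ih m, Finset.sum_mul]
        symm
        refine Finset.sum_subset_zero_on_sdiff (Finset.range_subset_range.mpr (by omega)) ?_ ?_
        · intro j hj
          simp only [Finset.mem_sdiff, Finset.mem_range] at hj
          rw [if_neg (by have := n.pos; omega)]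
        · intro j hj
          rw [Finset.mem_range] at hj
          rw [if_pos (by omega)]
          congr 2
          omega
      have hc : (n : MvPolynomial ℕ+ ℂ) * MvPolynomial.C (n : ℂ)⁻¹ = 1 := by
        rw [← map_natCast (MvPolynomial.C : ℂ →+* _), ← map_mul,
          mul_inv_cancel₀ (by exact_mod_cast n.ne_zero), map_one]
      rw [h2, Nat.add_sub_cancel]
      push_cast
      linear_combination skew m f * hc
    · rw [if_neg hnk, if_neg (by simp; omega), Finset.sum_eq_zero]
      · ring
      · intro j _
        rw [if_neg (by omega)]

/-- The identity `∑ₖ h_k(t₁ + z, t₂ + z² / 2, …) w^k = (1 - z w)⁻¹ ∑ₖ h_k(t) w^k`, read off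
coefficientwise. -/
theorem skew_completeSymInt (i : ℕ) (k : ℤ) :
    skew i (completeSymInt k) = completeSymInt (k - i) := by
  induction i using Nat.strong_induction_on generalizing k with
  | _ i ih =>
    rcases Nat.eq_zero_or_pos i with rfl | hi
    · simp [skew_zero]
    · have hi0 : (i : MvPolynomial ℕ+ ℂ) ≠ 0 := by exact_mod_cast hi.ne'
      refine mul_left_cancel₀ hi0 ?_
      rw [mul_skew, Finset.sum_congr rfl (g := fun _ => completeSymInt (k - i))]
      · simp
      · intro j hj
        rw [Finset.mem_range] at hj
        rw [pderiv_completeSymInt, ih _ (by omega), Nat.cast_sub (by omega)]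
        congr 1
        push_cast
        ring

/-- Subtracting a shifted multiple from `∑ₚ h_{k-p} z^p` leaves its first `d` terms. -/
theorem adjoinLetter_completeSymInt_sub (k : ℤ) (d : ℕ) :
    adjoinLetter (completeSymInt k) - X ^ d * adjoinLetter (completeSymInt (k - d)) =
      ∑ p ∈ Finset.range d, X ^ p * C (completeSymInt (k - p)) := by
  have h : ∀ (n : ℕ) (k : ℤ), (adjoinLetter (completeSymInt k)).coeff n = completeSymInt (k - n) :=
    skew_completeSymInt
  ext1 n
  rw [Polynomial.coeff_sub, Polynomial.coeff_X_pow_mul', Polynomial.finsetSum_coeff, h]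
  simp only [Polynomial.coeff_mul_C, Polynomial.coeff_X_pow, h]
  simp only [ite_mul, one_mul, zero_mul, Finset.sum_ite_eq, Finset.mem_range]
  by_cases hd : d ≤ n
  · rw [if_pos hd, if_neg (by omega), Nat.cast_sub hd]
    rw [sub_eq_zero]
    congr 1
    ring
  · rw [if_neg hd, if_pos (by omega), sub_zero]

/-! ### Jacobi-Trudi determinants and horizontal strips -/

/-- The Jacobi-Trudi determinant of a sequence of row lengths, trailing zeros being allowed. -/
noncomputable def jacobiTrudi {L : ℕ} (ν : Fin L → ℕ) : MvPolynomial ℕ+ ℂ :=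
  Matrix.det (Matrix.of fun i j : Fin L => completeSymInt ((ν i : ℤ) - (i : ℤ) + (j : ℤ)))

/-- The row length following `ν i`, with value `0` after the last one. -/
def nextRow {L : ℕ} (ν : Fin L → ℕ) (i : Fin L) : ℕ :=
  if h : (i : ℕ) + 1 < L then ν ⟨i + 1, h⟩ else 0

/-- The sequences `κ` that interlace with `ν`, that is `ν (i + 1) ≤ κ i ≤ ν i`, and have total
`r` less than `ν`: the shapes left over when a horizontal strip of size `r` is removed. -/
def stripRemovals {L : ℕ} (r : ℕ) (ν : Fin L → ℕ) : Finset (Fin L → ℕ) :=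
  (Fintype.piFinset fun i => Finset.Icc (nextRow ν i) (ν i)).filter
    fun κ => ∑ i, ν i = r + ∑ i, κ i

theorem nextRow_le {L : ℕ} {ν : Fin L → ℕ} (hν : Antitone ν) (i : Fin L) : nextRow ν i ≤ ν i := by
  unfold nextRow
  split_ifs with h
  · exact hν (Fin.le_def.mpr (Nat.le_succ _))
  · exact Nat.zero_le _

theorem le_nextRow {L : ℕ} {ν : Fin L → ℕ} (hν : Antitone ν) {i k : Fin L} (hik : i < k) :
    ν k ≤ nextRow ν i := by
  have h1 : (i : ℕ) + 1 ≤ k := hik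
  have h : (i : ℕ) + 1 < L := h1.trans_lt k.2
  rw [nextRow, dif_pos h]
  exact hν (Fin.le_def.mpr h1)

theorem mem_stripRemovals {L r : ℕ} {ν κ : Fin L → ℕ} :
    κ ∈ stripRemovals r ν ↔
      (∀ i, nextRow ν i ≤ κ i ∧ κ i ≤ ν i) ∧ ∑ i, ν i = r + ∑ i, κ i := by
  simp [stripRemovals]

theorem antitone_of_mem_stripRemovals {L r : ℕ} {ν κ : Fin L → ℕ} (hν : Antitone ν)
    (hκ : κ ∈ stripRemovals r ν) : Antitone κ := by
  rw [mem_stripRemovals] at hκ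
  intro i k hik
  rcases hik.eq_or_lt with rfl | hik
  · exact le_rfl
  · exact (hκ.1 k).2.trans ((le_nextRow hν hik).trans (hκ.1 i).1)

theorem jacobiTrudi_zero {L : ℕ} : jacobiTrudi (0 : Fin L → ℕ) = 1 := by
  rw [jacobiTrudi, Matrix.det_of_isUpperTriangular]
  · have : completeSymInt 0 = 1 := by
      simpa [completeSym_zero] using completeSymInt_natCast 0
    simp [this]
  · intro i j hij
    have : (j : ℕ) < i := hij
    exact completeSymInt_of_neg (by simp; omega)

/-- Subtracting from each row a multiple of the next row, all at once, does not change the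
determinant: it is multiplication by a unitriangular matrix. -/
theorem det_sub_mul_succ_row {R : Type*} [CommRing R] {L : ℕ} (A : Matrix (Fin L) (Fin L) R)
    (c : Fin L → R) :
    Matrix.det (Matrix.of fun i j =>
      A i j - c i * if h : (i : ℕ) + 1 < L then A ⟨i + 1, h⟩ j else 0) = A.det := by
  set U : Matrix (Fin L) (Fin L) R :=
    Matrix.of fun i k => (if i = k then 1 else 0) - if (k : ℕ) = i + 1 then c i else 0 with hU
  have hdetU : U.det = 1 := by
    rw [Matrix.det_of_isUpperTriangular]
    · simp [hU]
    · intro i j hij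
      have : (j : ℕ) < i := hij
      have h1 : i ≠ j := fun h => by simp [h] at this
      simp only [hU, Matrix.of_apply]
      rw [if_neg h1, if_neg (by omega), sub_zero]
  rw [← one_mul A.det, ← hdetU, ← Matrix.det_mul]
  congr 1
  ext i j
  rw [Matrix.mul_apply]
  simp only [hU, Matrix.of_apply, sub_mul, Finset.sum_sub_distrib, ite_mul, one_mul,
    zero_mul, Finset.sum_ite_eq, Finset.mem_univ, if_true]
  congr 1
  split_ifs with h
  · rw [Finset.sum_eq_single ⟨i + 1, h⟩]
    · rw [if_pos rfl]
    · intro k _ hk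
      exact if_neg fun h' => hk (Fin.ext h')
    · simp
  · rw [Finset.sum_eq_zero, mul_zero]
    intro k _
    have := k.2
    rw [if_neg (by omega)]

/-- The branching rule. Subtracting from each row a multiple of the next one is an operation of
determinant one; it turns the rows for the enlarged alphabet into finite sums of rows for the old
one, over precisely the interlacing row lengths, and multilinearity expands them. -/
theorem adjoinLetter_jacobiTrudi {L : ℕ} {ν : Fin L → ℕ} (hν : Antitone ν) :
    adjoinLetter (jacobiTrudi ν) =
      ∑ κ ∈ Fintype.piFinset fun i => Finset.Icc (nextRow ν i) (ν i),
        X ^ (∑ i, (ν i - κ i)) * C (jacobiTrudi κ) := by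
  set d : Fin L → ℕ := fun i => ν i + 1 - nextRow ν i with hd
  set A : Matrix (Fin L) (Fin L) (Polynomial (MvPolynomial ℕ+ ℂ)) :=
    Matrix.of fun i j => adjoinLetter (completeSymInt ((ν i : ℤ) - i + j)) with hA
  have hrow : (Matrix.of fun i j =>
        A i j - X ^ d i * if h : (i : ℕ) + 1 < L then A ⟨i + 1, h⟩ j else 0) =
      fun i => ∑ k ∈ Finset.Icc (nextRow ν i) (ν i),
        fun j : Fin L => X ^ (ν i - k) * C (completeSymInt ((k : ℤ) - i + j)) := by
    ext1 i
    intro j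
    have hle := nextRow_le hν i
    -- below the last row, `d i` carries the index past zero, so that the missing row counts as `0`
    have h1 : (if h : (i : ℕ) + 1 < L then A ⟨i + 1, h⟩ j else 0) =
        adjoinLetter (completeSymInt ((ν i : ℤ) - i + j - d i)) := by
      have hdi : (d i : ℤ) = ν i + 1 - nextRow ν i := by
        simp only [hd]
        rw [Nat.cast_sub (by omega)]
        push_cast
        ring
      rw [hdi, nextRow]
      split_ifs with h
      · simp only [hA, Matrix.of_apply]
        congr 2
        push_cast
        ring
      · have := j.2
        rw [completeSymInt_of_neg (by push_cast; omega), map_zero]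
    rw [Matrix.of_apply, h1]
    simp only [hA, Matrix.of_apply]
    rw [adjoinLetter_completeSymInt_sub, Finset.sum_apply]
    refine Finset.sum_nbij' (fun p => ν i - p) (fun k => ν i - k) ?_ ?_ ?_ ?_ ?_
    · intro p hp
      simp only [hd, Finset.mem_range, Finset.mem_Icc] at hp ⊢
      omega
    · intro p hp
      simp only [hd, Finset.mem_range, Finset.mem_Icc] at hp ⊢
      omega
    · intro p hp
      simp only [hd, Finset.mem_range] at hp
      omega
    · intro p hp
      simp only [Finset.mem_Icc] at hp
      omega
    · intro p hp
      simp only [hd, Finset.mem_range] at hp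
      have hp' : p ≤ ν i := by omega
      rw [Nat.sub_sub_self hp', Nat.cast_sub hp']
      congr 3
      ring
  have h2 : adjoinLetter (jacobiTrudi ν) = A.det := by
    rw [jacobiTrudi, AlgHom.map_det]
    rfl
  rw [h2, ← det_sub_mul_succ_row A fun i => X ^ d i, hrow]
  refine (MultilinearMap.map_sum_finset Matrix.detRowAlternating.toMultilinearMap _ _).trans
    (Finset.sum_congr rfl fun κ _ => ?_)
  have h3 := Matrix.det_mul_column (fun i => (X : Polynomial (MvPolynomial ℕ+ ℂ)) ^ (ν i - κ i))
    (Matrix.of fun i j : Fin L => C (completeSymInt ((κ i : ℤ) - i + j)))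
  rw [Finset.prod_pow_eq_pow_sum] at h3
  rw [jacobiTrudi, RingHom.map_det]
  exact h3

/-- The Pieri rule in its adjoint form. -/
theorem skew_jacobiTrudi {L : ℕ} {ν : Fin L → ℕ} (hν : Antitone ν) (r : ℕ) :
    skew r (jacobiTrudi ν) = ∑ κ ∈ stripRemovals r ν, jacobiTrudi κ := by
  rw [skew, adjoinLetter_jacobiTrudi hν, Polynomial.finsetSum_coeff, stripRemovals,
    Finset.sum_filter]
  refine Finset.sum_congr rfl fun κ hκ => ?_
  have hle : ∀ i ∈ Finset.univ, κ i ≤ ν i := fun i _ =>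
    (Finset.mem_Icc.mp (Fintype.mem_piFinset.mp hκ i)).2
  rw [Polynomial.coeff_mul_C, Polynomial.coeff_X_pow, Finset.sum_tsub_distrib _ hle, ite_mul,
    one_mul, zero_mul]
  have := Finset.sum_le_sum hle
  congr 1
  exact propext (by omega)

/-- The number of ways to exhaust the row lengths `ν` by removing `n` horizontal strips of size
`r` one after another. -/
def stripChains {L : ℕ} (r : ℕ) : ℕ → (Fin L → ℕ) → ℕ
  | 0, ν => if ν = 0 then 1 else 0
  | n + 1, ν => ∑ κ ∈ stripRemovals r ν, stripChains r n κ

/-! ### The Gaussian pairing -/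

theorem integrable_norm_pow_mul_exp_neg_norm_sq (k : ℕ) :
    Integrable fun z : ℂ => ‖z‖ ^ k * Real.exp (-‖z‖ ^ 2) := by
  have h := Complex.integral_rpow_mul_exp_neg_rpow (p := 2) (q := k) one_le_two
    (lt_of_lt_of_le (by norm_num) (Nat.cast_nonneg k))
  simp only [Real.rpow_natCast, Real.rpow_two] at h
  -- a function that is not integrable would have integral `0`
  refine not_imp_comm.mp integral_undef ?_
  rw [h]
  have := Real.Gamma_pos_of_pos (s := ((k : ℝ) + 2) / 2) (by positivity)
  positivity

theorem integral_norm_pow_mul_exp_neg_norm_sq (a : ℕ) :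
    ∫ z : ℂ, ‖z‖ ^ (2 * a) * Real.exp (-‖z‖ ^ 2) = Real.pi * a.factorial := by
  have h := Complex.integral_rpow_mul_exp_neg_rpow (p := 2) (q := (2 * a : ℕ)) one_le_two
    (lt_of_lt_of_le (by norm_num) (Nat.cast_nonneg _))
  simp only [Real.rpow_natCast, Real.rpow_two] at h
  rw [h, ← Real.Gamma_nat_eq_factorial]
  push_cast
  rw [show (2 * (a : ℝ) + 2) / 2 = a + 1 by ring]
  ring

theorem integrable_gaussian_moment (a b : ℕ) :
    Integrable fun z : ℂ => z ^ a * conj z ^ b * (Real.exp (-‖z‖ ^ 2) : ℂ) := by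
  refine (integrable_norm_pow_mul_exp_neg_norm_sq (a + b)).mono' ?_ (.of_forall fun z => ?_)
  · exact Continuous.aestronglyMeasurable (by fun_prop)
  · rw [norm_mul, norm_mul, norm_pow, norm_pow, RCLike.norm_conj, Complex.norm_real, pow_add,
      Real.norm_of_nonneg (Real.exp_pos _).le]

theorem integral_gaussian_moment (a b : ℕ) :
    ∫ z : ℂ, z ^ a * conj z ^ b * (Real.exp (-‖z‖ ^ 2) : ℂ) =
      if a = b then (Real.pi : ℂ) * a.factorial else 0 := by
  split_ifs with h
  · subst h
    have h1 := congrArg (fun x : ℝ => (x : ℂ)) (integral_norm_pow_mul_exp_neg_norm_sq a)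
    simp only [← integral_complex_ofReal] at h1
    push_cast at h1 ⊢
    rw [← h1]
    refine integral_congr_ae (.of_forall fun z => ?_)
    simp only [← mul_pow, Complex.mul_conj', pow_mul]
  · -- the rotation by `π / (a - b)` changes the sign of the integrand
    set c : Circle := Circle.exp (Real.pi / ((a : ℝ) - b)) with hc
    have hab : (a : ℂ) - b ≠ 0 := sub_ne_zero.mpr (by exact_mod_cast h)
    have hcc : (c : ℂ) ^ a * conj (c : ℂ) ^ b = -1 := by
      rw [← Circle.coe_inv_eq_conj, hc, ← Circle.exp_neg, Circle.coe_exp, Circle.coe_exp,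
        ← Complex.exp_nat_mul, ← Complex.exp_nat_mul, ← Complex.exp_add, ← Complex.exp_pi_mul_I]
      congr 1
      push_cast
      field_simp
      ring
    have hrot := (rotation c).measurePreserving.integral_comp
      (rotation c).toMeasurableEquiv.measurableEmbedding
      (fun z : ℂ => z ^ a * conj z ^ b * (Real.exp (-‖z‖ ^ 2) : ℂ))
    have hneg : ∀ z : ℂ, (rotation c z) ^ a * conj (rotation c z) ^ b *
        (Real.exp (-‖rotation c z‖ ^ 2) : ℂ) =
        -(z ^ a * conj z ^ b * (Real.exp (-‖z‖ ^ 2) : ℂ)) := by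
      intro z
      rw [LinearIsometryEquiv.norm_map, rotation_apply, map_mul, mul_pow, mul_pow]
      linear_combination (z ^ a * conj z ^ b * (Real.exp (-‖z‖ ^ 2) : ℂ)) * hcc
    simp only [hneg, integral_neg] at hrot
    exact self_eq_neg.mp hrot.symm

theorem mul_conj_mul_gaussian_monomial {r : ℕ} (a b : Fin r →₀ ℕ) (x y : ℂ) (t : Fin r → ℂ) :
    MvPolynomial.eval t (MvPolynomial.monomial a x) *
      conj (MvPolynomial.eval t (MvPolynomial.monomial b y)) *
      ∏ j, (Real.exp (-‖t j‖ ^ 2) : ℂ) =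
    x * conj y * ∏ j, (t j ^ a j * conj (t j) ^ b j * (Real.exp (-‖t j‖ ^ 2) : ℂ)) := by
  rw [MvPolynomial.eval_monomial, MvPolynomial.eval_monomial,
    Finsupp.prod_fintype _ _ fun _ => pow_zero _, Finsupp.prod_fintype _ _ fun _ => pow_zero _,
    Finset.prod_mul_distrib, Finset.prod_mul_distrib, map_mul, map_prod]
  simp only [map_pow]
  ring

theorem integrable_mul_conj_mul_gaussian {r : ℕ} (f g : MvPolynomial (Fin r) ℂ) :
    Integrable fun t : Fin r → ℂ => MvPolynomial.eval t f * conj (MvPolynomial.eval t g) *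
      ∏ j, (Real.exp (-‖t j‖ ^ 2) : ℂ) := by
  induction f using MvPolynomial.induction_on' with
  | monomial a x =>
    induction g using MvPolynomial.induction_on' with
    | monomial b y =>
      simp only [mul_conj_mul_gaussian_monomial]
      exact (Integrable.fintype_prod fun j => integrable_gaussian_moment (a j) (b j)).const_mul _
    | add p q hp hq =>
      simp only [map_add, mul_add, add_mul]
      exact hp.add hq
  | add p q hp hq =>
    simp only [map_add, add_mul]
    exact hp.add hq

/-- The Hermitian pairing `(f, g) ↦ ∫ f ḡ exp (-|t|²)` of polynomials in `r` complex variables. -/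
noncomputable def gaussianPairing (r : ℕ) :
    MvPolynomial (Fin r) ℂ →+ MvPolynomial (Fin r) ℂ →+ ℂ :=
  AddMonoidHom.mk' (fun f => AddMonoidHom.mk' (fun g =>
    ∫ t : Fin r → ℂ, MvPolynomial.eval t f * conj (MvPolynomial.eval t g) *
      ∏ j, (Real.exp (-‖t j‖ ^ 2) : ℂ))
    fun g g' => by
      rw [← integral_add (integrable_mul_conj_mul_gaussian f g)
        (integrable_mul_conj_mul_gaussian f g')]
      simp only [map_add, mul_add, add_mul])
    fun f f' => by
      refine AddMonoidHom.ext fun g => ?_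
      simp only [AddMonoidHom.mk'_apply, AddMonoidHom.add_apply]
      rw [← integral_add (integrable_mul_conj_mul_gaussian f g)
        (integrable_mul_conj_mul_gaussian f' g)]
      simp only [map_add, add_mul]

theorem gaussianPairing_apply {r : ℕ} (f g : MvPolynomial (Fin r) ℂ) :
    gaussianPairing r f g = ∫ t : Fin r → ℂ, MvPolynomial.eval t f *
      conj (MvPolynomial.eval t g) * ∏ j, (Real.exp (-‖t j‖ ^ 2) : ℂ) :=
  rfl

theorem gaussianPairing_monomial {r : ℕ} (a b : Fin r →₀ ℕ) (x y : ℂ) :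
    gaussianPairing r (MvPolynomial.monomial a x) (MvPolynomial.monomial b y) =
      x * conj y * ∏ j, if a j = b j then (Real.pi : ℂ) * (a j).factorial else 0 := by
  rw [gaussianPairing_apply]
  simp only [mul_conj_mul_gaussian_monomial]
  rw [integral_const_mul, integral_fintype_prod_volume_eq_prod
    fun j z => z ^ a j * conj z ^ b j * (Real.exp (-‖z‖ ^ 2) : ℂ)]
  simp only [integral_gaussian_moment]

theorem gaussianPairing_one_one (r : ℕ) : gaussianPairing r 1 1 = (Real.pi : ℂ) ^ r := by
  have h := gaussianPairing_monomial (r := r) 0 0 1 1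
  simpa [← MvPolynomial.C_apply] using h

/-- Multiplication by a variable is adjoint to differentiation. -/
theorem gaussianPairing_mul_X {r : ℕ} (i : Fin r) (f g : MvPolynomial (Fin r) ℂ) :
    gaussianPairing r f (g * MvPolynomial.X i) =
      gaussianPairing r (MvPolynomial.pderiv i f) g := by
  induction f using MvPolynomial.induction_on' with
  | monomial a x =>
    induction g using MvPolynomial.induction_on' with
    | monomial b y =>
      rw [MvPolynomial.pderiv_monomial, MvPolynomial.X, MvPolynomial.monomial_mul, mul_one,
        gaussianPairing_monomial, gaussianPairing_monomial,
        ← Finset.mul_prod_erase _ _ (Finset.mem_univ i),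
        ← Finset.mul_prod_erase (a := i) (s := Finset.univ) (h := Finset.mem_univ i)]
      have h1 : ∀ j ∈ Finset.univ.erase i,
          (if a j = (b + Finsupp.single i 1 : Fin r →₀ ℕ) j then
            (Real.pi : ℂ) * (a j).factorial else 0) =
          if (a - Finsupp.single i 1 : Fin r →₀ ℕ) j = b j then
            (Real.pi : ℂ) * ((a - Finsupp.single i 1 : Fin r →₀ ℕ) j).factorial else 0 := by
        intro j hj
        have hji : i ≠ j := (Finset.ne_of_mem_erase hj).symm
        simp [hji]
      rw [Finset.prod_congr rfl h1]
      have h2 : (if a i = (b + Finsupp.single i 1 : Fin r →₀ ℕ) i then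
            (Real.pi : ℂ) * (a i).factorial else 0) =
          a i * if (a - Finsupp.single i 1 : Fin r →₀ ℕ) i = b i then
            (Real.pi : ℂ) * ((a - Finsupp.single i 1 : Fin r →₀ ℕ) i).factorial else 0 := by
        simp only [Finsupp.add_apply, Finsupp.tsub_apply, Finsupp.single_eq_same]
        rcases a i with _ | m
        · simp
        · simp only [Nat.add_right_cancel_iff, Nat.add_sub_cancel, Nat.factorial_succ]
          split_ifs
          · push_cast
            ring
          · rw [mul_zero]
      rw [h2]
      ring
    | add p q hp hq => rw [add_mul, map_add, map_add, hp, hq]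
  | add p q hp hq =>
    simp only [map_add, AddMonoidHom.add_apply, hp, hq]

/-! ### Adjoint of multiplication by a complete symmetric polynomial -/

/-- The specialization `t_j = 0` for `j > r`. -/
noncomputable def truncate (r : ℕ) : MvPolynomial ℕ+ ℂ →ₐ[ℂ] MvPolynomial (Fin r) ℂ :=
  MvPolynomial.aeval fun j : ℕ+ =>
    if h : (j : ℕ) - 1 < r then MvPolynomial.X ⟨(j : ℕ) - 1, h⟩ else 0

theorem eval_truncate {r : ℕ} (t : Fin r → ℂ) (f : MvPolynomial ℕ+ ℂ) :
    MvPolynomial.eval t (truncate r f) = MvPolynomial.eval (zeroPad t) f := by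
  have : (MvPolynomial.aeval t).comp (truncate r) =
      (MvPolynomial.aeval (zeroPad t) : MvPolynomial ℕ+ ℂ →ₐ[ℂ] ℂ) := by
    ext j
    simp only [truncate, zeroPad, AlgHom.comp_apply, MvPolynomial.aeval_X]
    split_ifs <;> simp
  have h := DFunLike.congr_fun this f
  simpa [MvPolynomial.coe_aeval_eq_eval] using h

theorem truncate_X {r : ℕ} (i : Fin r) :
    truncate r (MvPolynomial.X (i : ℕ).succPNat) = MvPolynomial.X i := by
  simp [truncate]

theorem truncate_pderiv {r : ℕ} (i : Fin r) (f : MvPolynomial ℕ+ ℂ) :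
    truncate r (MvPolynomial.pderiv (i : ℕ).succPNat f) =
      MvPolynomial.pderiv i (truncate r f) := by
  induction f using MvPolynomial.induction_on with
  | C a =>
    rw [← MvPolynomial.algebraMap_eq, AlgHom.commutes, Derivation.map_algebraMap,
      Derivation.map_algebraMap, map_zero]
  | add p q hp hq => simp only [map_add, hp, hq]
  | mul_X p n hp =>
    have h : truncate r (MvPolynomial.pderiv (i : ℕ).succPNat (MvPolynomial.X n)) =
        MvPolynomial.pderiv i (truncate r (MvPolynomial.X n)) := by
      by_cases hn : (i : ℕ).succPNat = n
      · rw [← hn, truncate_X]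
        simp
      · rw [MvPolynomial.pderiv_X_of_ne (Ne.symm hn), map_zero, truncate, MvPolynomial.aeval_X]
        split_ifs with h
        · rw [MvPolynomial.pderiv_X_of_ne]
          intro h'
          apply hn
          apply PNat.eq
          have h2 := congrArg Fin.val h'
          have := n.pos
          simp at h2 ⊢
          omega
        · simp
    simp only [Derivation.leibniz, map_mul, map_add, smul_eq_mul, hp, h]

/-- The polynomial `h_k(t₁, t₂ / 2, t₃ / 3, …)`. -/
noncomputable def scaledCompleteSym (k : ℕ) : MvPolynomial ℕ+ ℂ :=
  MvPolynomial.aeval (fun j : ℕ+ => MvPolynomial.C (j : ℂ)⁻¹ * MvPolynomial.X j) (completeSym k)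

theorem eval_scaledCompleteSym {r : ℕ} (t : Fin r → ℂ) (k : ℕ) :
    MvPolynomial.eval (zeroPad t) (scaledCompleteSym k) =
      MvPolynomial.eval (zeroPad fun j => t j / ((j : ℂ) + 1)) (completeSym k) := by
  have : (MvPolynomial.aeval (zeroPad t)).comp (MvPolynomial.aeval
        fun j : ℕ+ => MvPolynomial.C (j : ℂ)⁻¹ * MvPolynomial.X j) =
      (MvPolynomial.aeval (zeroPad fun j => t j / ((j : ℂ) + 1)) :
        MvPolynomial ℕ+ ℂ →ₐ[ℂ] ℂ) := by
    ext j
    simp only [AlgHom.comp_apply, MvPolynomial.aeval_X, map_mul, zeroPad]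
    split_ifs
    · have : ((j : ℕ) : ℂ) = ((j : ℕ) - 1 : ℕ) + 1 := by
        rw [Nat.cast_sub j.pos]
        simp
      rw [← MvPolynomial.algebraMap_eq, AlgHom.commutes]
      simp only [Algebra.algebraMap_self, RingHom.id_apply]
      rw [div_eq_inv_mul, this]
    · simp
  have h := DFunLike.congr_fun this (completeSym k)
  simpa [MvPolynomial.coe_aeval_eq_eval, scaledCompleteSym] using h

theorem succ_mul_scaledCompleteSym (k : ℕ) :
    ((k : MvPolynomial ℕ+ ℂ) + 1) * scaledCompleteSym (k + 1) =
      ∑ j ∈ Finset.range (k + 1), MvPolynomial.X j.succPNat * scaledCompleteSym (k - j) := by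
  have h := congrArg (MvPolynomial.aeval
    (fun j : ℕ+ => MvPolynomial.C (j : ℂ)⁻¹ * MvPolynomial.X j : ℕ+ → MvPolynomial ℕ+ ℂ))
    (succ_mul_completeSym k)
  simp only [map_mul, map_sum, map_add, map_one, map_natCast, MvPolynomial.aeval_X] at h
  rw [scaledCompleteSym, h]
  refine Finset.sum_congr rfl fun j _ => ?_
  have hj : ((j : MvPolynomial ℕ+ ℂ) + 1) * MvPolynomial.C ((j.succPNat : ℕ) : ℂ)⁻¹ = 1 := by
    rw [← Nat.cast_succ, ← map_natCast (MvPolynomial.C : ℂ →+* _), ← map_mul, Nat.succPNat_coe,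
      mul_inv_cancel₀ (by exact_mod_cast j.succ_ne_zero), map_one]
  rw [← mul_assoc, hj, one_mul, scaledCompleteSym]

theorem scaledCompleteSym_zero : scaledCompleteSym 0 = 1 := by
  rw [scaledCompleteSym, completeSym_zero, map_one]

/-- Up to the factor `π ^ r`, the Gaussian pairing of `f(t₁, t₂, …)` with `g(t₁, t₂ / 2, …)` is the
Hall inner product of `f` and `g`; accordingly multiplication by `h_k`, in rescaled form, is adjoint
to `skew k`. The variables in Newton's recurrence for `h_k` have index at most `k ≤ r`, hence
survive the truncation. -/
theorem gaussianPairing_mul_scaledCompleteSym {r k : ℕ} (hk : k ≤ r) (f g : MvPolynomial ℕ+ ℂ) :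
    gaussianPairing r (truncate r f) (truncate r (g * scaledCompleteSym k)) =
      gaussianPairing r (truncate r (skew k f)) (truncate r g) := by
  induction k using Nat.strong_induction_on generalizing f g with
  | _ k ih =>
    rcases k with _ | k
    · rw [scaledCompleteSym_zero, mul_one, skew_zero]
    · have hk0 : k + 1 ≠ 0 := k.succ_ne_zero
      refine (smul_right_inj hk0).mp ?_
      rw [← map_nsmul, ← map_nsmul, ← AddMonoidHom.nsmul_apply, ← map_nsmul, ← map_nsmul,
        nsmul_eq_mul, nsmul_eq_mul, mul_skew, mul_left_comm]
      push_cast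
      rw [succ_mul_scaledCompleteSym, Finset.mul_sum, map_sum, map_sum, map_sum, map_sum,
        AddMonoidHom.finsetSum_apply]
      refine Finset.sum_congr rfl fun j hj => ?_
      rw [Finset.mem_range] at hj
      have hX := truncate_X (⟨j, by omega⟩ : Fin r)
      have hD := truncate_pderiv (⟨j, by omega⟩ : Fin r) f
      simp only at hX hD
      rw [mul_comm (MvPolynomial.X _), ← mul_assoc, map_mul (truncate r) _ (MvPolynomial.X _), hX,
        gaussianPairing_mul_X, ← hD, ih (k - j) (by omega) (by omega)]

/-- Each factor `h_r` removes a horizontal strip of size `r`. -/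
theorem gaussianPairing_jacobiTrudi {L : ℕ} (r n : ℕ) {ν : Fin L → ℕ} (hν : Antitone ν)
    (hsum : ∑ i, ν i = r * n) :
    gaussianPairing r (truncate r (jacobiTrudi ν)) (truncate r (scaledCompleteSym r ^ n)) =
      (Real.pi : ℂ) ^ r * stripChains r n ν := by
  induction n generalizing ν with
  | zero =>
    have h0 : ν = 0 := by
      ext i
      exact Finset.sum_eq_zero_iff.mp (by simpa using hsum) i (Finset.mem_univ i)
    rw [h0, jacobiTrudi_zero, pow_zero, map_one, gaussianPairing_one_one]
    simp [stripChains]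
  | succ n ih =>
    rw [pow_succ, gaussianPairing_mul_scaledCompleteSym le_rfl, skew_jacobiTrudi hν, map_sum,
      map_sum, AddMonoidHom.finsetSum_apply, stripChains, Nat.cast_sum, Finset.mul_sum]
    refine Finset.sum_congr rfl fun κ hκ => ih (antitone_of_mem_stripRemovals hν hκ) ?_
    have := (mem_stripRemovals.mp hκ).2
    rw [hsum, mul_add, mul_one, add_comm] at this
    exact (Nat.add_left_cancel this).symm

/-! ### Semistandard fillings as chains of horizontal strips -/

/-- The filling `T`, a family of rows of lengths `ν`, is semistandard with content
`1^r 2^r ⋯ n^r`; entries beyond the row lengths are `0`. -/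
structure IsRectTableau {L : ℕ} (r n : ℕ) (ν : Fin L → ℕ) (T : Fin L → ℕ → ℕ) : Prop where
  row_weak : ∀ ⦃i j₁ j₂⦄, j₁ ≤ j₂ → j₂ < ν i → T i j₁ ≤ T i j₂
  col_strict : ∀ ⦃i₁ i₂ j⦄, i₁ < i₂ → j < ν i₂ → T i₁ j < T i₂ j
  zeros : ∀ ⦃i j⦄, ν i ≤ j → T i j = 0
  content : ∀ k, ∑ i, ((Finset.range (ν i)).filter fun j => T i j = k).card =
    if k ∈ Finset.Icc 1 n then r else 0

theorem IsRectTableau.mem_Icc {L r n : ℕ} {ν : Fin L → ℕ} {T : Fin L → ℕ → ℕ}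
    (hT : IsRectTableau r n ν T) {i : Fin L} {j : ℕ} (hj : j < ν i) :
    1 ≤ T i j ∧ T i j ≤ n := by
  by_contra hk
  have h := hT.content (T i j)
  rw [if_neg (by simpa using hk), Finset.sum_eq_zero_iff] at h
  have h' := Finset.card_eq_zero.mp (h i (Finset.mem_univ i))
  have : j ∈ (Finset.range (ν i)).filter fun j' => T i j' = T i j := by simp [hj]
  simp [h'] at this

/-- Extension of a filling of the shape `κ` to the shape `ν` by the entry `n + 1`. -/
def fillStrip {L : ℕ} (n : ℕ) (ν κ : Fin L → ℕ) (T : Fin L → ℕ → ℕ) (i : Fin L) (j : ℕ) : ℕ :=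
  if j < κ i then T i j else if j < ν i then n + 1 else 0

theorem card_filter_fillStrip {L : ℕ} (n k : ℕ) {ν κ : Fin L → ℕ} (T : Fin L → ℕ → ℕ) {i : Fin L}
    (hκ : κ i ≤ ν i) :
    ((Finset.range (ν i)).filter fun j => fillStrip n ν κ T i j = k).card =
      ((Finset.range (κ i)).filter fun j => T i j = k).card +
        if k = n + 1 then ν i - κ i else 0 := by
  rw [Finset.range_eq_Ico, ← Finset.Ico_union_Ico_eq_Ico (Nat.zero_le _) hκ, Finset.filter_union,
    Finset.card_union_of_disjoint
      (Finset.disjoint_filter_filter (Finset.Ico_disjoint_Ico_consecutive _ _ _)),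
    ← Finset.range_eq_Ico]
  congr 1
  · congr 1
    refine Finset.filter_congr fun j hj => ?_
    rw [fillStrip, if_pos (Finset.mem_range.mp hj)]
  · have h : ∀ j ∈ Finset.Ico (κ i) (ν i), (fillStrip n ν κ T i j = k ↔ k = n + 1) := by
      intro j hj
      rw [Finset.mem_Ico] at hj
      rw [fillStrip, if_neg (not_lt.mpr hj.1), if_pos hj.2, eq_comm]
    rw [Finset.filter_congr h]
    split_ifs with hk <;> simp [hk]

theorem isRectTableau_fillStrip {L r n : ℕ} {ν κ : Fin L → ℕ} (hν : Antitone ν)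
    (hκ : κ ∈ stripRemovals r ν) {T : Fin L → ℕ → ℕ} (hT : IsRectTableau r n κ T) :
    IsRectTableau r (n + 1) ν (fillStrip n ν κ T) := by
  rw [mem_stripRemovals] at hκ
  obtain ⟨hκ, hsum⟩ := hκ
  refine ⟨?_, ?_, ?_, ?_⟩
  · intro i j₁ j₂ hj hj₂
    unfold fillStrip
    by_cases h₂ : j₂ < κ i
    · rw [if_pos h₂, if_pos (hj.trans_lt h₂)]
      exact hT.row_weak hj h₂
    · rw [if_neg h₂, if_pos hj₂]
      split_ifs with h₁
      · exact (hT.mem_Icc h₁).2.trans (Nat.le_succ n)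
      · exact le_rfl
      · exact Nat.zero_le _
  · intro i₁ i₂ j hi hj
    have h₁ : j < κ i₁ := hj.trans_le ((le_nextRow hν hi).trans (hκ i₁).1)
    unfold fillStrip
    rw [if_pos h₁, if_pos hj]
    split_ifs with h₂
    · exact hT.col_strict hi h₂
    · exact Nat.lt_succ_of_le (hT.mem_Icc h₁).2
  · intro i j hj
    rw [fillStrip, if_neg (not_lt.mpr ((hκ i).2.trans hj)), if_neg (not_lt.mpr hj)]
  · intro k
    have hsub := Finset.sum_tsub_distrib Finset.univ fun i _ => (hκ i).2
    simp only [card_filter_fillStrip n k T (hκ _).2]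
    rw [Finset.sum_add_distrib, hT.content k]
    by_cases hk : k = n + 1
    · simp only [hk, if_true, hsub]
      simp
      omega
    · simp only [if_neg hk, Finset.sum_const_zero, add_zero, Finset.mem_Icc]
      congr 1
      exact propext (by omega)

/-- In a semistandard filling, the entries other than the largest one form a semistandard filling
of a shape obtained by removing a horizontal strip. -/
theorem IsRectTableau.exists_fillStrip {L r n : ℕ} {ν : Fin L → ℕ} {T : Fin L → ℕ → ℕ}
    (hν : Antitone ν) (hT : IsRectTableau r (n + 1) ν T) :
    ∃ κ ∈ stripRemovals r ν, ∃ T₀, IsRectTableau r n κ T₀ ∧ fillStrip n ν κ T₀ = T := by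
  set κ : Fin L → ℕ := fun i => ((Finset.range (ν i)).filter fun j => T i j ≤ n).card
  have hlt : ∀ i j, j < κ i ↔ j < ν i ∧ T i j ≤ n := by
    intro i j
    constructor
    · intro hj
      by_contra hcon
      -- otherwise all cells with entries at most `n` lie to the left of column `j`
      have hsub : ((Finset.range (ν i)).filter fun j' => T i j' ≤ n) ⊆ Finset.range j := by
        intro j' hj'
        rw [Finset.mem_filter, Finset.mem_range] at hj'
        rw [Finset.mem_range]
        by_contra hle
        rw [not_lt] at hle
        exact hcon ⟨hle.trans_lt hj'.1, (hT.row_weak hle hj'.1).trans hj'.2⟩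
      have := Finset.card_le_card hsub
      rw [Finset.card_range] at this
      exact absurd hj (not_lt.mpr this)
    · rintro ⟨hj, hjn⟩
      have hsub : Finset.range (j + 1) ⊆ (Finset.range (ν i)).filter fun j' => T i j' ≤ n := by
        intro j' hj'
        rw [Finset.mem_range, Nat.lt_succ_iff] at hj'
        rw [Finset.mem_filter, Finset.mem_range]
        exact ⟨hj'.trans_lt hj, (hT.row_weak hj' hj).trans hjn⟩
      have := Finset.card_le_card hsub
      rwa [Finset.card_range] at this
  have hle : ∀ i, κ i ≤ ν i := fun i =>
    (Finset.card_filter_le _ _).trans (Finset.card_range _).le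
  set T₀ : Fin L → ℕ → ℕ := fun i j => if j < κ i then T i j else 0 with hT₀
  have hT₀_lt : ∀ {i j}, j < κ i → T₀ i j = T i j := fun h => if_pos h
  have hfill : fillStrip n ν κ T₀ = T := by
    ext i j
    unfold fillStrip
    split_ifs with h₁ h₂
    · exact hT₀_lt h₁
    · have := (hT.mem_Icc h₂).2
      have := mt (fun h => (hlt i j).mpr ⟨h₂, h⟩) h₁
      omega
    · exact (hT.zeros (not_lt.mp h₂)).symm
  have hcontent : ∀ k, ∑ i, ((Finset.range (κ i)).filter fun j => T₀ i j = k).card +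
      (if k = n + 1 then ∑ i, (ν i - κ i) else 0) = if k ∈ Finset.Icc 1 (n + 1) then r else 0 := by
    intro k
    rw [← hT.content k, ← hfill]
    simp only [card_filter_fillStrip n k T₀ (hle _)]
    rw [Finset.sum_add_distrib]
    split_ifs <;> simp
  have htop : ∑ i, ((Finset.range (κ i)).filter fun j => T₀ i j = n + 1).card = 0 := by
    refine Finset.sum_eq_zero fun i _ => Finset.card_eq_zero.mpr (Finset.filter_eq_empty_iff.mpr ?_)
    intro j hj h
    rw [Finset.mem_range] at hj
    rw [hT₀_lt hj] at h
    have := ((hlt i j).mp hj).2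
    omega
  refine ⟨κ, ?_, T₀, ⟨?_, ?_, ?_, ?_⟩, hfill⟩
  · rw [mem_stripRemovals]
    refine ⟨fun i => ⟨?_, hle i⟩, ?_⟩
    · unfold nextRow
      split_ifs with h
      · by_contra hcon
        rw [not_le] at hcon
        have h1 := hT.col_strict (i₁ := i) (Fin.lt_def.mpr (Nat.lt_succ_self _)) hcon
        have h2 := (hT.mem_Icc hcon).2
        have h3 : κ i < ν i := hcon.trans_le (hν (Fin.le_def.mpr (Nat.le_succ _)))
        exact lt_irrefl _ ((hlt i (κ i)).mpr ⟨h3, by omega⟩)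
      · exact Nat.zero_le _
    · have h1 := hcontent (n + 1)
      have h2 := Finset.sum_le_sum fun i (_ : i ∈ Finset.univ) => hle i
      rw [htop, if_pos rfl, if_pos (by simp),
        Finset.sum_tsub_distrib Finset.univ fun i _ => hle i] at h1
      omega
  · intro i j₁ j₂ hj hj₂
    rw [hT₀_lt hj₂, hT₀_lt (hj.trans_lt hj₂)]
    exact hT.row_weak hj (hj₂.trans_le (hle i))
  · intro i₁ i₂ j hi hj
    have h1 := hT.col_strict hi (hj.trans_le (hle i₂))
    have h2 : j < κ i₁ := (hlt i₁ j).mpr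
      ⟨hj.trans_le ((hle i₂).trans (hν hi.le)), h1.le.trans ((hlt i₂ j).mp hj).2⟩
    rwa [hT₀_lt hj, hT₀_lt h2]
  · intro i j hj
    exact if_neg (not_lt.mpr hj)
  · intro k
    by_cases hk : k = n + 1
    · rw [hk, htop, if_neg (by simp)]
    · have h1 := hcontent k
      rw [if_neg hk, add_zero] at h1
      rw [h1]
      congr 1
      simp only [Finset.mem_Icc]
      exact propext (by omega)

/-- Semistandard fillings correspond to chains of horizontal strips. -/
theorem exists_finset_isRectTableau {L : ℕ} (r n : ℕ) {ν : Fin L → ℕ} (hν : Antitone ν) :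
    ∃ F : Finset (Fin L → ℕ → ℕ),
      (∀ T, T ∈ F ↔ IsRectTableau r n ν T) ∧ F.card = stripChains r n ν := by
  classical
  induction n generalizing ν with
  | zero =>
    by_cases h0 : ν = 0
    · refine ⟨{0}, fun T => ?_, by simp [stripChains, h0]⟩
      rw [Finset.mem_singleton]
      constructor
      · rintro rfl
        constructor <;> simp [h0]
      · intro hT
        ext i j
        exact hT.zeros (by simp [h0])
    · refine ⟨∅, fun T => ?_, by simp [stripChains, h0]⟩
      simp only [Finset.notMem_empty, false_iff]
      intro hT
      apply h0
      ext i
      by_contra hi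
      have := hT.mem_Icc (Nat.pos_of_ne_zero hi)
      omega
  | succ n ih =>
    have ih' : ∀ κ : Fin L → ℕ, ∃ F : Finset (Fin L → ℕ → ℕ), Antitone κ →
        (∀ T, T ∈ F ↔ IsRectTableau r n κ T) ∧ F.card = stripChains r n κ := by
      intro κ
      by_cases hκ : Antitone κ
      · exact (ih hκ).imp fun F hF _ => hF
      · exact ⟨∅, fun h => absurd h hκ⟩
    choose F hF using ih'
    have hmem : ∀ κ ∈ stripRemovals r ν, ∀ T, T ∈ F κ ↔ IsRectTableau r n κ T := fun κ hκ =>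
      (hF κ (antitone_of_mem_stripRemovals hν hκ)).1
    refine ⟨(stripRemovals r ν).biUnion fun κ => (F κ).image (fillStrip n ν κ), fun T => ?_, ?_⟩
    · simp only [Finset.mem_biUnion, Finset.mem_image]
      constructor
      · rintro ⟨κ, hκ, T₀, hT₀, rfl⟩
        exact isRectTableau_fillStrip hν hκ ((hmem κ hκ T₀).mp hT₀)
      · intro hT
        obtain ⟨κ, hκ, T₀, hT₀, h⟩ := hT.exists_fillStrip hν
        exact ⟨κ, hκ, T₀, (hmem κ hκ T₀).mpr hT₀, h⟩
    · -- the shape can be read off from the position of the entries `n + 1`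
      have hshape : ∀ κ ∈ stripRemovals r ν, ∀ κ' ∈ stripRemovals r ν, ∀ T T',
          T' ∈ F κ' → fillStrip n ν κ T = fillStrip n ν κ' T' → κ' ≤ κ := by
        intro κ _ κ' hκ' T T' hT' h i
        by_contra hlt
        rw [not_le] at hlt
        have h1 := congrFun (congrFun h i) (κ i)
        have h2 := (((hmem κ' hκ' T').mp hT').mem_Icc hlt).2
        have h3 := ((mem_stripRemovals.mp hκ').1 i).2
        rw [fillStrip, fillStrip, if_neg (lt_irrefl _), if_pos (hlt.trans_le h3),
          if_pos hlt] at h1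
        omega
      rw [Finset.card_biUnion, stripChains]
      · refine Finset.sum_congr rfl fun κ hκ => ?_
        rw [Finset.card_image_of_injOn, (hF κ (antitone_of_mem_stripRemovals hν hκ)).2]
        intro T hT T' hT' h
        have hT1 := (hmem κ hκ T).mp hT
        have hT2 := (hmem κ hκ T').mp hT'
        ext i j
        by_cases hj : j < κ i
        · have h1 := congrFun (congrFun h i) j
          rwa [fillStrip, fillStrip, if_pos hj, if_pos hj] at h1
        · rw [hT1.zeros (not_lt.mp hj), hT2.zeros (not_lt.mp hj)]
      · intro κ hκ κ' hκ' hne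
        refine Finset.disjoint_left.mpr ?_
        intro S hS hS'
        obtain ⟨T, hT, rfl⟩ := Finset.mem_image.mp hS
        obtain ⟨T', hT', h⟩ := Finset.mem_image.mp hS'
        exact hne (le_antisymm (hshape κ' hκ' κ hκ T' T hT h)
          (hshape κ hκ κ' hκ' T T' hT' h.symm))

/-! ### Tableaux on a Young diagram -/

theorem lt_colLen_of_mem {μ : YoungDiagram} {i j : ℕ} (h : (i, j) ∈ μ) : i < μ.colLen 0 :=
  YoungDiagram.mem_iff_lt_colLen.mp (μ.up_left_mem le_rfl (Nat.zero_le j) h)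

theorem card_filter_cells (μ : YoungDiagram) (p : ℕ → ℕ → Prop) [∀ i j, Decidable (p i j)] :
    (μ.cells.filter fun c => p c.1 c.2).card =
      ∑ i : Fin (μ.colLen 0), ((Finset.range (μ.rowLen i)).filter fun j => p i j).card := by
  rw [← Finset.card_sigma]
  symm
  refine Finset.card_bij (fun s _ => ((s.1 : ℕ), s.2)) ?_ ?_ ?_
  · rintro ⟨i, j⟩ h
    simpa [YoungDiagram.mem_cells, YoungDiagram.mem_iff_lt_rowLen] using h
  · rintro ⟨i, j⟩ _ ⟨i', j'⟩ _ h
    simp only [Prod.mk.injEq] at h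
    obtain rfl := Fin.ext h.1
    obtain rfl := h.2
    rfl
  · rintro ⟨i, j⟩ h
    simp only [Finset.mem_filter, YoungDiagram.mem_cells] at h
    refine ⟨⟨⟨i, lt_colLen_of_mem h.1⟩, j⟩, ?_, rfl⟩
    simpa [YoungDiagram.mem_iff_lt_rowLen] using h

theorem card_eq_sum_rowLen (μ : YoungDiagram) :
    μ.card = ∑ i : Fin (μ.colLen 0), μ.rowLen i := by
  simpa using card_filter_cells μ fun _ _ => True

theorem antitone_rowLen (μ : YoungDiagram) :
    Antitone fun i : Fin (μ.colLen 0) => μ.rowLen i :=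
  fun i j hij => μ.rowLen_anti i j hij

/-- Semistandard tableaux of shape `μ`, restricted to the nonempty rows of `μ`. -/
def rectTableauEquiv (μ : YoungDiagram) (r n : ℕ) :
    {T : SemistandardYoungTableau μ //
      ∀ k : ℕ, entryCount T k = if k ∈ Finset.Icc 1 n then r else 0} ≃
    {T : Fin (μ.colLen 0) → ℕ → ℕ // IsRectTableau r n (fun i => μ.rowLen i) T} where
  toFun T := ⟨fun i j => T.1 i j,
    { row_weak := fun _ _ _ hj hj₂ =>
        T.1.row_weak_of_le hj (YoungDiagram.mem_iff_lt_rowLen.mpr hj₂)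
      col_strict := fun _ _ _ hi hj =>
        T.1.col_strict hi (YoungDiagram.mem_iff_lt_rowLen.mpr hj)
      zeros := fun _ _ hj =>
        T.1.zeros fun h => not_lt.mpr hj (YoungDiagram.mem_iff_lt_rowLen.mp h)
      content := fun k => by
        rw [← T.2 k, entryCount, card_filter_cells μ fun i j => T.1 i j = k] }⟩
  invFun T := ⟨
    { entry := fun i j => if h : i < μ.colLen 0 then T.1 ⟨i, h⟩ j else 0
      row_weak' := fun {i j₁ j₂} hj hcell => by
        have hi := lt_colLen_of_mem hcell
        rw [dif_pos hi, dif_pos hi]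
        exact T.2.row_weak hj.le (YoungDiagram.mem_iff_lt_rowLen.mp hcell)
      col_strict' := fun {i₁ i₂ j} hi hcell => by
        have hi₂ := lt_colLen_of_mem hcell
        rw [dif_pos hi₂, dif_pos (hi.trans hi₂)]
        exact T.2.col_strict hi (YoungDiagram.mem_iff_lt_rowLen.mp hcell)
      zeros' := fun {i j} hcell => by
        split_ifs with hi
        · exact T.2.zeros (not_lt.mp fun h => hcell (YoungDiagram.mem_iff_lt_rowLen.mpr h))
        · rfl },
    fun k => by
      rw [← T.2.content k, entryCount]
      refine (card_filter_cells μ fun i j =>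
        (if h : i < μ.colLen 0 then T.1 ⟨i, h⟩ j else 0) = k).trans ?_
      simp⟩
  left_inv T := by
    refine Subtype.ext (SemistandardYoungTableau.ext fun i j => ?_)
    change (if h : i < μ.colLen 0 then T.1 i j else 0) = T.1 i j
    split_ifs with hi
    · rfl
    · exact (T.1.zeros fun h => hi (lt_colLen_of_mem h)).symm
  right_inv T := by
    refine Subtype.ext (funext fun i => funext fun j => ?_)
    exact dif_pos i.2

theorem rectKostka_eq_stripChains (μ : YoungDiagram) (r n : ℕ) :
    rectKostka μ r n = stripChains r n fun i : Fin (μ.colLen 0) => μ.rowLen i := by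
  obtain ⟨F, hF, hcard⟩ := exists_finset_isRectTableau r n (antitone_rowLen μ)
  rw [rectKostka, Nat.card_congr (rectTableauEquiv μ r n), ← hcard, ← Nat.card_eq_finsetCard]
  exact Nat.card_congr (Equiv.subtypeEquivRight fun T => (hF T).symm)

theorem integrand_eq (μ : YoungDiagram) (r n : ℕ) (t : Fin r → ℂ) :
    integrand μ r n t = MvPolynomial.eval t (truncate r (schurPoly μ)) *
      conj (MvPolynomial.eval t (truncate r (scaledCompleteSym r ^ n))) *
        ∏ j, (Real.exp (-‖t j‖ ^ 2) : ℂ) := by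
  rw [integrand, eval_truncate, eval_truncate, map_pow (MvPolynomial.eval _),
    eval_scaledCompleteSym]

end KostkaIntegral

theorem mainTheorem3 (r n : ℕ) (hr : 1 ≤ r) (μ : YoungDiagram) (hμ : μ.card = r * n) :
    Integrable (integrand μ r n) volume ∧
      (rectKostka μ r n : ℂ)
        = 1 / (Real.pi : ℂ) ^ r * ∫ t : Fin r → ℂ, integrand μ r n t := by
  have hpi : (Real.pi : ℂ) ^ r ≠ 0 := pow_ne_zero _ (by exact_mod_cast Real.pi_ne_zero)
  have hpair := gaussianPairing_jacobiTrudi r n (antitone_rowLen μ)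
    ((card_eq_sum_rowLen μ).symm.trans hμ)
  rw [← rectKostka_eq_stripChains, gaussianPairing_apply] at hpair
  refine ⟨(integrable_mul_conj_mul_gaussian _ _).congr
    (.of_forall fun t => (integrand_eq μ r n t).symm), ?_⟩
  simp only [integrand_eq]
  rw [one_div, eq_inv_mul_iff_mul_eq₀ hpi]
  exact hpair.symm
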